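/- Conventions. For $\theta\in[0,2\pi)$ let $p=(\cos\theta,\sin\theta)$; the Radon transform of $f:\mathbb R^2\to\mathbb C$ in the direction $p$ is $$\mathcal R_pf(t)=\int_{-\infty}^{\infty} f(t\cos\theta-s\sin\theta,\;t\sin\theta+s\cos\theta)\,ds ,\qquad t\in\mathbb R.$$ Let $\widehat g(\gamma)=\int_{\mathbb R^2}g(x)e^{-ix\cdot\gamma}\,dx$, and let $\nu_2(g)=\sup\{s\in\mathbb R:\int_{\mathbb R^2}|\widehat g(\xi)|^2(1+\|\xi\|_2^2)^s\,d\xi<\infty\}\in[-\infty,\infty]$. A function $\varphi:\mathbb R^2\to\mathbb C$ is positive definite if $\sum_{j,k=1}^N\alpha_j\overline{\alpha_k}\,\varphi(x_j-x_k)$ is real and $>0$ for all $N\in\mathbb N$, all pairwise distinct $x_1,\dots,x_N\in\mathbb R^2$ and all $0\neq\alpha\in\mathbb C^N$. Let $$V(\varphi,\mathbb Z^2)=\Big\{\sum_{k\in\mathbb Z^2}c_k\,\varphi(\cdot-k):\ \sum_{k\in\mathbb Z^2}|c_k|^2<\infty\Big\}$$ (for continuous, compactly supported $\varphi$ the sums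 are locally finite and are taken pointwise, so the elements are continuous functions). For $S\subseteq\mathbb R^2$ put $$\mathcal N_S=\{y\neq0:\ x\cdot y=0\text{ for some }0\neq x\in S\},\qquad \mathrm{dv}_S=\Big\{\tfrac{x}{\|x\|_2}:\ 0\neq x\in S\Big\}.$$ **Theorem 5.5.** Let $\varphi:\mathbb R^2\to\mathbb C$ be continuous, compactly supported and positive definite, with $\nu_2(\varphi)>1/2$, $\widehat\varphi(0)>0$ and $\mathrm{supp}(\varphi)\subseteq[N_1,M_1]\times[N_2,M_2]$. Let $a_1,b_1,a_2,b_2\in\mathbb R$ and put $$E=\big([\lceil a_1-M_1\rceil,\lfloor b_1-N_1\rfloor]\times[\lceil a_2-M_2\rceil,\lfloor b_2-N_2\rfloor]\big)\cap\mathbb Z^2=\{k_1,\dots,k_{\#E}\},$$ $$E^+=\{x-y:\ x,y\in E,\ x\neq y\}$$ (so $E^+=\emptyset$ if $\#E\le 1$). Then for every direction vector $p\in\{(\cos\theta,\sin\theta):\theta\in[0,2\pi)\}\setminus \mathrm{dv}_{\mathcal N_{E^+}}$, every $f\in V(\varphi,\mathbb Z^2)$ with $\mathrm{supp}(f)\subseteq[a_1,b_1]\times[a_2,b_2]$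 is uniquely determined, among all such functions, by its samples $\mathcal R_pf(p\cdot k_1),\dots,\mathcal R_pf(p\cdot k_{\#E})$: if $f,g\in V(\varphi,\mathbb Z^2)$ both have support in $[a_1,b_1]\times[a_2,b_2]$ and $\mathcal R_pf(p\cdot k_l)=\mathcal R_pg(p\cdot k_l)$ for $l=1,\dots,\#E$, then $f=g$. -/

import Mathlib

open scoped ComplexOrder

namespace SingleAngleCT

noncomputable section

/-- The Euclidean plane. -/
abbrev Plane : Type := EuclideanSpace ℝ (Fin 2)

/-- The integer point `k ∈ ℤ²`, as a point of the plane. -/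
def latticePoint (k : ℤ × ℤ) : Plane := !₂[(k.1 : ℝ), (k.2 : ℝ)]

/-- The closed rectangle `[l₁, u₁] × [l₂, u₂]`. -/
def rectangle (l₁ u₁ l₂ u₂ : ℝ) : Set Plane :=
  {x | x 0 ∈ Set.Icc l₁ u₁ ∧ x 1 ∈ Set.Icc l₂ u₂}

/-- The Fourier transform `g^(γ) = ∫ g(x) exp(-i x·γ) dx` of an integrable function on the plane
(without the factor `2π` in the exponent). -/
def fourierPlane (g : Plane → ℂ) (γ : Plane) : ℂ :=
  ∫ x : Plane, g x * Complex.exp (-(Complex.I * ((inner ℝ x γ : ℝ) : ℂ)))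

/-- Positive definiteness: for finitely many pairwise distinct points and a nonzero complex
coefficient vector the quadratic form is a positive real number (`0 < z` in `ℂ` says that `z` is
real and positive). -/
def IsPositiveDefinite (φ : Plane → ℂ) : Prop :=
  ∀ (N : ℕ) (x : Fin N → Plane), Function.Injective x → ∀ α : Fin N → ℂ, α ≠ 0 →
    0 < ∑ j, ∑ k, α j * (starRingEnd ℂ) (α k) * φ (x j - x k)

/-- Membership of an integrable function in the Sobolev space `H^s(ℝ²)`:
`∫ |g^(ξ)|² (1 + |ξ|²)^s dξ < ∞`. -/
def MemSobolevPlane (s : ℝ) (g : Plane → ℂ) : Prop :=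
  MeasureTheory.Integrable g ∧
    ∫⁻ ξ : Plane, ENNReal.ofReal (‖fourierPlane g ξ‖ ^ 2 * (1 + ‖ξ‖ ^ 2) ^ s) < ⊤

/-- The Sobolev smoothness `ν₂(g) = sup {s : g ∈ H^s(ℝ²)}`, with values in `[-∞, ∞]`. -/
def sobolevSmoothness (g : Plane → ℂ) : EReal :=
  sSup ((fun s : ℝ => (s : EReal)) '' {s : ℝ | MemSobolevPlane s g})

/-- The Radon transform of `f` in the direction `p = (p₁, p₂)`:
`R_p f (t) = ∫ f (t (p₁, p₂) + s (-p₂, p₁)) ds`. -/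
def radon (p : Plane) (f : Plane → ℂ) (t : ℝ) : ℂ :=
  ∫ s : ℝ, f !₂[t * p 0 - s * p 1, t * p 1 + s * p 0]

/-- The shift-invariant space `V(φ, ℤ²)`: the functions `∑ c_k φ(· - k)` with a square summable
coefficient family. For a continuous compactly supported `φ` at each point only finitely many
terms are nonzero, and the pointwise sum is the continuous representative of the sum in `L²`. -/
def shiftInvariantSpace (φ : Plane → ℂ) : Set (Plane → ℂ) :=
  {f | ∃ c : ℤ × ℤ → ℂ, Summable (fun k => ‖c k‖ ^ 2) ∧
    ∀ x : Plane, HasSum (fun k => c k * φ (x - latticePoint k)) (f x)}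

/-- The set `([⌈a₁ - M₁⌉, ⌊b₁ - N₁⌋] × [⌈a₂ - M₂⌉, ⌊b₂ - N₂⌋]) ∩ ℤ²`. -/
def shiftIndexSet (N₁ M₁ N₂ M₂ a₁ b₁ a₂ b₂ : ℝ) : Finset (ℤ × ℤ) :=
  Finset.Icc ⌈a₁ - M₁⌉ ⌊b₁ - N₁⌋ ×ˢ Finset.Icc ⌈a₂ - M₂⌉ ⌊b₂ - N₂⌋

/-- The set `E⁺` of the differences of two distinct elements of `E`, as points of the plane. It is
empty if `E` has at most one element. -/
def differenceSet (E : Finset (ℤ × ℤ)) : Set Plane :=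
  {z | ∃ x ∈ E, ∃ y ∈ E, x ≠ y ∧ z = latticePoint x - latticePoint y}

/-- The unit vector `(cos θ, sin θ)`. -/
def direction (θ : ℝ) : Plane := !₂[Real.cos θ, Real.sin θ]

/-- All direction vectors `(cos θ, sin θ)`, `θ ∈ [0, 2π)`. -/
def directions : Set Plane := direction '' Set.Ico 0 (2 * Real.pi)

/-- The direction vector set `dv_S`: the directions of the nonzero elements of `S`. -/
def directionSet (S : Set Plane) : Set Plane :=
  {p | ∃ θ : ℝ, p = direction θ ∧ ∃ x ∈ S, x ≠ 0 ∧ x = ‖x‖ • direction θ}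

/-- The null set of `S`: the nonzero vectors orthogonal to some nonzero element of `S`. -/
def nullSet (S : Set Plane) : Set Plane :=
  {y | y ≠ 0 ∧ ∃ x ∈ S, x ≠ 0 ∧ inner ℝ x y = 0}

end

end SingleAngleCT

open SingleAngleCT

namespace SingleAngleCT

section

open MeasureTheory Filter Topology Complex
open scoped Pointwise

/-! Let `h = f - g`, with lattice coefficients `c`, and let `d k` be the inner product of `h` with
`φ(· - k)`. The support condition gives `d k = 0` for `k ∉ E`. The argument works with `d` because
this vanishing is immediate, whereas `c` is not shown to vanish off `E`.

Convolving `c` with the autocorrelation of `φ` gives `d`. On the Fourier side, `G ĥ = D φ̂`, where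
`G ≥ 0` is the symbol of the autocorrelation and `D` is the exponential sum with coefficients `d k`.
Put `w = ∑ conj (d k) h(· + k)`, so that `ŵ = conj D · ĥ` and `G ŵ = |D|² φ̂`. Positive definiteness
gives `φ̂ ≥ 0`. Unless `G` vanishes on the whole line `ℝp`, its zeros there are isolated, so `ŵ ≥ 0`
on the line by continuity.

The samples enter through `R_p w(0) = ∑ conj (d k) R_p h(p·k) = 0`. By the slice theorem `R_p w` is
a continuous function with nonnegative Fourier transform that vanishes at `0`, hence its transform
vanishes. In both cases `|D|² φ̂ = 0` on `ℝp`. Since `φ̂(0) ≠ 0`, `D` vanishes near `0` on that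
line. The frequencies `p·k`, `k ∈ E`, are distinct by the choice of `p`, so `d = 0`. Then `h` is
orthogonal to all translates of `φ`, hence to itself.

The core is `latticeCorrelation_eq_zero_of_radon_eq_zero`, completed by
`eq_zero_of_latticeCorrelation_eq_zero`. -/

/-- The character `x ↦ exp(-i x·ξ)` of the plane. -/
noncomputable def planeChar (ξ x : Plane) : ℂ :=
  Complex.exp (-(Complex.I * ((inner ℝ x ξ : ℝ) : ℂ)))

/-! ### Characters and lattice points -/

lemma planeChar_zero (ξ : Plane) : planeChar ξ 0 = 1 := by simp [planeChar]

lemma planeChar_add (ξ x y : Plane) : planeChar ξ (x + y) = planeChar ξ x * planeChar ξ y := by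
  simp only [planeChar, ← Complex.exp_add, inner_add_left]
  congr 1; push_cast; ring

lemma planeChar_neg (ξ x : Plane) : planeChar ξ (-x) = starRingEnd ℂ (planeChar ξ x) := by
  simp [planeChar, ← Complex.exp_conj]

lemma planeChar_sub (ξ x y : Plane) :
    planeChar ξ (x - y) = planeChar ξ x * starRingEnd ℂ (planeChar ξ y) := by
  rw [sub_eq_add_neg, planeChar_add, planeChar_neg]

lemma continuous_planeChar (ξ : Plane) : Continuous (planeChar ξ) := by
  unfold planeChar; fun_prop

lemma fourierPlane_eq (g : Plane → ℂ) (ξ : Plane) :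
    fourierPlane g ξ = ∫ x, g x * planeChar ξ x := rfl

lemma latticePoint_sub (j k : ℤ × ℤ) : latticePoint (j - k) = latticePoint j - latticePoint k := by
  ext i; fin_cases i <;> simp [latticePoint]

lemma latticePoint_injective : Function.Injective latticePoint := by
  intro j k h
  have h0 := congrArg (fun x : Plane => x 0) h
  have h1 := congrArg (fun x : Plane => x 1) h
  simp [latticePoint] at h0 h1
  exact Prod.ext h0 h1

/-! ### Averaging over large integer squares -/

/-- The integer square `{0, …, n-1}²`. -/
noncomputable def latticeSquare (n : ℕ) : Finset (ℤ × ℤ) :=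
  Finset.Ico 0 (n : ℤ) ×ˢ Finset.Ico 0 (n : ℤ)

lemma tendsto_card_filter_shift (m : ℤ) :
    Tendsto (fun n : ℕ => (((Finset.Ico 0 (n : ℤ)).filter fun k => k + m ∈ Finset.Ico 0 (n : ℤ)).card
      : ℝ) / n) atTop (𝓝 1) := by
  have h1 : Tendsto (fun n : ℕ => 1 - (|m| : ℝ) / n) atTop (𝓝 1) := by
    simpa using (tendsto_const_div_atTop_nhds_zero_nat (|m| : ℝ)).const_sub 1
  refine h1.congr' ?_
  filter_upwards [eventually_gt_atTop m.natAbs] with n hn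
  have hn0 : (n : ℝ) ≠ 0 := by
    have : 0 < n := by omega
    positivity
  have h2 : (Finset.Ico 0 (n : ℤ)).filter (fun k => k + m ∈ Finset.Ico 0 (n : ℤ))
      = Finset.Ico (max 0 (-m)) (min n (n - m)) := by
    ext k; simp only [Finset.mem_filter, Finset.mem_Ico]; omega
  have h3 : ((min (n : ℤ) (n - m) - max 0 (-m)).toNat : ℤ) = n - |m| := by
    rw [Int.toNat_of_nonneg (by omega)]
    rcases abs_cases m with h | h <;> omega
  have h4 : ((min (n : ℤ) (n - m) - max 0 (-m)).toNat : ℝ) = n - |(m : ℝ)| := by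
    exact_mod_cast h3
  rw [h2, Int.card_Ico, h4]
  field_simp

lemma tendsto_card_latticeSquare_shift (m : ℤ × ℤ) :
    Tendsto (fun n : ℕ => (((latticeSquare n).filter fun k => k + m ∈ latticeSquare n).card : ℝ)
      / n ^ 2) atTop (𝓝 1) := by
  have h := (tendsto_card_filter_shift m.1).mul (tendsto_card_filter_shift m.2)
  rw [one_mul] at h
  refine h.congr fun n => ?_
  have : (latticeSquare n).filter (fun k => k + m ∈ latticeSquare n)
      = ((Finset.Ico 0 (n : ℤ)).filter fun k => k + m.1 ∈ Finset.Ico 0 (n : ℤ)) ×ˢ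
        ((Finset.Ico 0 (n : ℤ)).filter fun k => k + m.2 ∈ Finset.Ico 0 (n : ℤ)) := by
    ext k
    simp only [latticeSquare, Finset.mem_filter, Finset.mem_product, Prod.fst_add, Prod.snd_add]
    tauto
  rw [this, Finset.card_product]
  push_cast
  rw [div_mul_div_comm, sq]

/-- Fejér averaging: in the double sum over the square of side `n`, each difference `m` occurs `n²
(1 + o(1))` times, so dividing by `n²` and letting `n → ∞` leaves the plain sum of `ψ`. -/
lemma sum_nonneg_of_latticeSquare_form_nonneg (ψ : ℤ × ℤ → ℂ) (B : Finset (ℤ × ℤ))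
    (hB : ∀ m ∉ B, ψ m = 0)
    (h : ∀ n : ℕ, 0 ≤ ∑ j ∈ latticeSquare n, ∑ k ∈ latticeSquare n, ψ (j - k)) :
    0 ≤ ∑ m ∈ B, ψ m := by
  have key : ∀ n : ℕ, ∑ j ∈ latticeSquare n, ∑ k ∈ latticeSquare n, ψ (j - k) =
      ∑ m ∈ B, (((latticeSquare n).filter fun k => k + m ∈ latticeSquare n).card : ℂ) * ψ m := by
    intro n
    rw [Finset.sum_comm]
    have h1 : ∀ k ∈ latticeSquare n, ∑ j ∈ latticeSquare n, ψ (j - k) =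
        ∑ m ∈ B, if k + m ∈ latticeSquare n then ψ m else 0 := by
      intro k _
      rw [← Finset.sum_filter]
      refine Finset.sum_bij_ne_zero (fun j _ _ => j - k) ?_ ?_ ?_ ?_
      · intro j hj hne
        simp only [Finset.mem_filter]
        refine ⟨by_contra fun hh => hne (hB _ hh), by simpa using hj⟩
      · intro a _ _ b _ _ hab; simpa using hab
      · intro m hm hne
        rw [Finset.mem_filter] at hm
        exact ⟨k + m, hm.2, by simpa using hne, by simp⟩
      · intros; rfl
    rw [Finset.sum_congr rfl h1, Finset.sum_comm]
    refine Finset.sum_congr rfl fun m _ => ?_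
    rw [← Finset.sum_filter, Finset.sum_const, nsmul_eq_mul]
  have hlim : Tendsto (fun n : ℕ => ∑ m ∈ B,
      (((((latticeSquare n).filter fun k => k + m ∈ latticeSquare n).card : ℝ) / n ^ 2 : ℝ) : ℂ) * ψ m)
      atTop (𝓝 (∑ m ∈ B, ψ m)) := by
    refine tendsto_finsetSum _ fun m _ => ?_
    have := ((Complex.continuous_ofReal.tendsto _).comp
      (tendsto_card_latticeSquare_shift m)).mul_const (ψ m)
    simpa using this
  refine ge_of_tendsto' hlim fun n => ?_
  have : ∑ m ∈ B, (((((latticeSquare n).filter fun k => k + m ∈ latticeSquare n).card : ℝ)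
      / n ^ 2 : ℝ) : ℂ) * ψ m = ((((n : ℝ) ^ 2)⁻¹ : ℝ) : ℂ) *
      ∑ j ∈ latticeSquare n, ∑ k ∈ latticeSquare n, ψ (j - k) := by
    rw [key, Finset.mul_sum]
    refine Finset.sum_congr rfl fun m _ => ?_
    push_cast; ring
  rw [this]
  exact mul_nonneg (by exact_mod_cast by positivity) (h n)

/-! ### Positive definite functions have nonnegative Fourier transform -/

lemma IsPositiveDefinite.finset_sum_nonneg {φ : Plane → ℂ} (hφ : IsPositiveDefinite φ) {ι : Type*}
    (A : Finset ι) (x : ι → Plane) (hx : Function.Injective x) (α : ι → ℂ) :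
    0 ≤ ∑ j ∈ A, ∑ k ∈ A, α j * starRingEnd ℂ (α k) * φ (x j - x k) := by
  let e : Fin A.card ≃ A := A.equivFin.symm
  have h1 : ∑ j ∈ A, ∑ k ∈ A, α j * starRingEnd ℂ (α k) * φ (x j - x k) =
      ∑ j, ∑ k, α (e j) * starRingEnd ℂ (α (e k)) * φ (x (e j) - x (e k)) := by
    rw [← Finset.sum_coe_sort, ← e.sum_comp]
    refine Finset.sum_congr rfl fun j _ => ?_
    rw [← Finset.sum_coe_sort, ← e.sum_comp]
  rw [h1]
  by_cases h0 : (fun i => α (e i)) = 0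
  · have : ∀ i, α (e i) = 0 := fun i => congrFun h0 i
    simp [this]
  · exact (hφ _ (fun i => x (e i)) (hx.comp (Subtype.val_injective.comp e.injective)) _ h0).le

/-- The planar point `(m₁ / n, m₂ / n)` in coordinates. -/
noncomputable def gridPoint (n : ℕ) (m : ℤ × ℤ) : Fin 2 → ℝ := ![(m.1 : ℝ) / n, (m.2 : ℝ) / n]

lemma gridPoint_injective {n : ℕ} (hn : n ≠ 0) : Function.Injective (gridPoint n) := by
  intro j k h
  have hn' : (n : ℝ) ≠ 0 := by exact_mod_cast hn
  have h0 := congrFun h 0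
  have h1 := congrFun h 1
  simp [gridPoint, div_left_inj' hn'] at h0 h1
  exact Prod.ext h0 h1

lemma gridPoint_sub (n : ℕ) (j k : ℤ × ℤ) :
    gridPoint n (j - k) = gridPoint n j - gridPoint n k := by
  ext i; fin_cases i <;> simp [gridPoint, sub_div]

lemma range_gridPoint {n : ℕ} [NeZero n] :
    Set.range (gridPoint n) = (n : ℝ)⁻¹ •
      (Submodule.span ℤ (Set.range (Pi.basisFun ℝ (Fin 2))) : Set (Fin 2 → ℝ)) := by
  have hn' : (n : ℝ) ≠ 0 := by exact_mod_cast NeZero.ne n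
  ext v
  rw [← Submodule.coe_pointwise_smul, SetLike.mem_coe, BoxIntegral.unitPartition.mem_smul_span_iff]
  constructor
  · rintro ⟨m, rfl⟩ i
    fin_cases i
    · exact ⟨m.1, by simp [gridPoint]; field_simp⟩
    · exact ⟨m.2, by simp [gridPoint]; field_simp⟩
  · intro h
    obtain ⟨a, ha⟩ := h 0
    obtain ⟨b, hb⟩ := h 1
    refine ⟨(a, b), ?_⟩
    simp only [algebraMap_int_eq, eq_intCast] at ha hb
    ext i; fin_cases i
    · simp [gridPoint, ha]; field_simp
    · simp [gridPoint, hb]; field_simp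

/-- Riemann sums over the grids `n⁻¹ ℤ²` of a continuous function vanishing off a square. -/
lemma tendsto_riemannSum_grid (F : (Fin 2 → ℝ) → ℝ) (hF : Continuous F) (R : ℕ)
    (hR : ∀ x, F x ≠ 0 → ∀ i, |x i| ≤ R) :
    Tendsto (fun n : ℕ => (∑ m ∈ Finset.Icc (-((n : ℤ) * R)) (n * R) ×ˢ
      Finset.Icc (-((n : ℤ) * R)) (n * R), F (gridPoint n m)) / n ^ 2) atTop (𝓝 (∫ x, F x)) := by
  let s : Set (Fin 2 → ℝ) := Set.Icc (fun _ => -(R : ℝ)) (fun _ => (R : ℝ))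
  have hs : ∀ x, F x ≠ 0 → x ∈ s := fun x hx =>
    ⟨fun i => (abs_le.1 (hR x hx i)).1, fun i => (abs_le.1 (hR x hx i)).2⟩
  have h := tendsto_tsum_div_pow_atTop_integral s F hF (Metric.isBounded_Icc _ _) measurableSet_Icc
    ((convex_Icc _ _).addHaar_frontier volume)
  rw [setIntegral_eq_integral_of_forall_compl_eq_zero
    (fun x hx => by_contra fun hh => hx (hs x hh))] at h
  refine h.congr' ?_
  filter_upwards [eventually_gt_atTop 0] with n hn
  have : NeZero n := ⟨hn.ne'⟩
  have hn' : (0 : ℝ) < n := by exact_mod_cast hn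
  congr 1
  rw [tsum_subtype (s ∩ (n : ℝ)⁻¹ •
    (Submodule.span ℤ (Set.range (Pi.basisFun ℝ (Fin 2))) : Set (Fin 2 → ℝ))) F, ← range_gridPoint]
  -- `F` vanishes off `s`, so restricting to `s` changes nothing.
  have : (s ∩ Set.range (gridPoint n)).indicator F = (Set.range (gridPoint n)).indicator F := by
    ext x
    by_cases hx : F x = 0
    · simp [Set.indicator, hx]
    · by_cases hr : x ∈ Set.range (gridPoint n) <;> simp [hs x hx, hr]
  rw [this, ← tsum_subtype, tsum_range F (gridPoint_injective hn.ne'), tsum_eq_sum]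
  intro m hm
  by_contra hne
  apply hm
  have h0 := hR _ hne 0
  have h1 := hR _ hne 1
  simp only [gridPoint, Matrix.cons_val_zero, Matrix.cons_val_one, abs_div, Nat.abs_cast,
    div_le_iff₀ hn'] at h0 h1
  rw [abs_le] at h0 h1
  simp only [Finset.mem_product, Finset.mem_Icc]
  refine ⟨⟨?_, ?_⟩, ?_, ?_⟩ <;> (rify; linarith [h0.1, h0.2, h1.1, h1.2])

/-- The integral is a limit of Riemann sums over `n⁻¹ ℤ²`. Each of these is nonnegative by Fejér
averaging, applied to the quadratic forms of `φ` with the values of the character as coefficients.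
-/
lemma fourierPlane_nonneg_of_isPositiveDefinite {φ : Plane → ℂ} (hφ : IsPositiveDefinite φ)
    (hc : Continuous φ) (hs : HasCompactSupport φ) (ξ : Plane) : 0 ≤ fourierPlane φ ξ := by
  obtain ⟨C, hC⟩ := hs.isCompact.isBounded.exists_norm_le
  let R : ℕ := ⌈C⌉₊
  have hR : ∀ x : Plane, φ x ≠ 0 → ∀ i, |x i| ≤ R := fun x hx i =>
    ((PiLp.norm_apply_le x i).trans (hC x (subset_tsupport _ hx))).trans (Nat.le_ceil C)
  let H : (Fin 2 → ℝ) → ℂ := fun v => φ (WithLp.toLp 2 v) * planeChar ξ (WithLp.toLp 2 v)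
  have hH : Continuous H := by
    have h1 : Continuous fun v : Fin 2 → ℝ => (WithLp.toLp 2 v : Plane) :=
      PiLp.continuous_toLp 2 _
    exact (hc.comp h1).mul ((continuous_planeChar ξ).comp h1)
  have hHR : ∀ v, H v ≠ 0 → ∀ i, |v i| ≤ R := fun v hv i =>
    hR (WithLp.toLp 2 v) (left_ne_zero_of_mul hv) i
  have hint : ∫ v, H v = fourierPlane φ ξ :=
    (PiLp.volume_preserving_toLp (Fin 2)).integral_comp
      (MeasurableEquiv.toLp 2 (Fin 2 → ℝ)).measurableEmbedding (fun x => φ x * planeChar ξ x)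
  have hHint : Integrable H := by
    refine hH.integrable_of_hasCompactSupport ?_
    refine HasCompactSupport.intro (isCompact_Icc (a := fun _ : Fin 2 => -(R : ℝ))
      (b := fun _ => (R : ℝ))) fun v hv => by_contra fun hh => hv ?_
    exact ⟨fun i => (abs_le.1 (hHR v hh i)).1, fun i => (abs_le.1 (hHR v hh i)).2⟩
  let B : ℕ → Finset (ℤ × ℤ) := fun n => Finset.Icc (-((n : ℤ) * R)) (n * R) ×ˢ
      Finset.Icc (-((n : ℤ) * R)) (n * R)
  have hpos : ∀ n : ℕ, 0 < n → 0 ≤ ∑ m ∈ B n, H (gridPoint n m) := by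
    intro n hn
    have hn' : (0 : ℝ) < n := by exact_mod_cast hn
    refine sum_nonneg_of_latticeSquare_form_nonneg _ _ ?_ ?_
    · intro m hm
      by_contra hne
      apply hm
      have h0 := hHR _ hne 0
      have h1 := hHR _ hne 1
      simp only [gridPoint, Matrix.cons_val_zero, Matrix.cons_val_one, abs_div, Nat.abs_cast,
        div_le_iff₀ hn'] at h0 h1
      rw [abs_le] at h0 h1
      simp only [B, Finset.mem_product, Finset.mem_Icc]
      refine ⟨⟨?_, ?_⟩, ?_, ?_⟩ <;> (rify; linarith [h0.1, h0.2, h1.1, h1.2])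
    · intro N
      have := hφ.finset_sum_nonneg (latticeSquare N) (fun m => (WithLp.toLp 2 (gridPoint n m) : Plane))
        ((WithLp.toLp_injective 2).comp (gridPoint_injective hn.ne'))
        (fun m => planeChar ξ (WithLp.toLp 2 (gridPoint n m)))
      refine this.trans_eq (Finset.sum_congr rfl fun j _ => Finset.sum_congr rfl fun k _ => ?_)
      simp only [H, gridPoint_sub, WithLp.toLp_sub, planeChar_sub]
      ring
  have hre := tendsto_riemannSum_grid (fun v => (H v).re) (Complex.continuous_re.comp hH) R
    (fun v hv => hHR v fun h0 => hv (by simp [h0]))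
  have him := tendsto_riemannSum_grid (fun v => (H v).im) (Complex.continuous_im.comp hH) R
    (fun v hv => hHR v fun h0 => hv (by simp [h0]))
  have hre' : ∫ v, (H v).re = (fourierPlane φ ξ).re := by rw [← hint]; exact integral_re hHint
  have him' : ∫ v, (H v).im = (fourierPlane φ ξ).im := by rw [← hint]; exact integral_im hHint
  rw [hre'] at hre
  rw [him'] at him
  rw [Complex.nonneg_iff]
  constructor
  · refine ge_of_tendsto hre ?_
    filter_upwards [eventually_gt_atTop 0] with n hn
    have := (Complex.nonneg_iff.1 (hpos n hn)).1
    rw [Complex.re_sum] at this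
    exact div_nonneg this (by positivity)
  · refine tendsto_nhds_unique (tendsto_const_nhds.congr' ?_) him
    filter_upwards [eventually_gt_atTop 0] with n hn
    have := (Complex.nonneg_iff.1 (hpos n hn)).2
    rw [Complex.im_sum] at this
    rw [← this, zero_div]

/-! ### Nonnegative Fourier transforms on the line -/

/-- A continuous function on the line that is integrable, has a nonnegative Fourier transform and
vanishes at the origin has vanishing Fourier transform. -/
lemma fourier_eq_zero_of_nonneg_of_apply_zero {u : ℝ → ℂ} (hu : Integrable u) (huc : Continuous u)
    (hpos : ∀ τ, 0 ≤ FourierTransform.fourier u τ) (h0 : u 0 = 0) (τ : ℝ) :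
    FourierTransform.fourier u τ = 0 := by
  have hF : Continuous (FourierTransform.fourier u) :=
    VectorFourier.fourierIntegral_continuous Real.continuous_fourierChar
      (by exact continuous_inner) hu
  have hbound : ∃ C, ∀ t, ‖FourierTransform.fourier u t‖ ≤ C :=
    ⟨_, fun t => VectorFourier.norm_fourierIntegral_le_integral_norm _ _ _ _ t⟩
  have hgauss : ∀ c : ℝ, 0 < c → Integrable fun w : ℝ => Real.exp (-c⁻¹ * ‖w‖ ^ 2) := by
    intro c hc
    simpa using integrable_exp_neg_mul_sq (b := c⁻¹) (by positivity)
  have hint : ∀ c : ℝ, 0 < c → Integrable fun w : ℝ =>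
      Real.exp (-c⁻¹ * ‖w‖ ^ 2) * (FourierTransform.fourier u w).re := by
    intro c hc
    obtain ⟨C, hC⟩ := hbound
    refine (hgauss c hc).mul_bdd (c := C) (Complex.continuous_re.comp hF).aestronglyMeasurable ?_
    exact ae_of_all _ fun t => (Complex.abs_re_le_norm _).trans (hC t)
  -- Gaussian-regularized Fourier inversion at the origin: the regularized integrals of the
  -- transform converge to `u 0 = 0`.
  have hlim : Tendsto (fun c : ℝ => ∫ w : ℝ, Real.exp (-c⁻¹ * ‖w‖ ^ 2) *
      (FourierTransform.fourier u w).re) atTop (𝓝 0) := by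
    have h1 := Real.tendsto_integral_gaussian_smul' hu (v := 0) huc.continuousAt
    rw [h0] at h1
    have h2 := (Complex.continuous_re.tendsto _).comp h1
    rw [Complex.zero_re] at h2
    refine h2.congr' ?_
    filter_upwards [Ioi_mem_atTop 0] with c (hc : 0 < c)
    have J : Integrable (fun w : ℝ ↦ cexp (- c⁻¹ * ‖w‖ ^ 2 + 2 * Real.pi * I * (inner ℝ (0 : ℝ) w : ℝ))) :=
      GaussianFourier.integrable_cexp_neg_mul_sq_norm_add (by simpa) _ _
    -- The multiplication formula moves the Fourier transform from `u` to the Gaussian.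
    have h3 : ∫ w : ℝ, FourierTransform.fourier (fun w : ℝ ↦
        cexp (- c⁻¹ * ‖w‖ ^ 2 + 2 * Real.pi * I * (inner ℝ (0 : ℝ) w : ℝ))) w • u w =
        ∫ w : ℝ, cexp (- c⁻¹ * ‖w‖ ^ 2 + 2 * Real.pi * I * (inner ℝ (0 : ℝ) w : ℝ)) •
          FourierTransform.fourier u w := by
      have h3' := (VectorFourier.integral_fourierIntegral_smul_eq_flip (L := innerₗ ℝ)
      Real.continuous_fourierChar continuous_inner J hu)
      simpa using! h3'
    have h4 : ∀ w : ℝ, Real.exp (-c⁻¹ * ‖w‖ ^ 2) * (FourierTransform.fourier u w).re =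
        (cexp (- c⁻¹ * ‖w‖ ^ 2 + 2 * Real.pi * I * (inner ℝ (0 : ℝ) w : ℝ)) •
          FourierTransform.fourier u w).re := by
      intro w
      rw [smul_eq_mul, inner_zero_left]
      rw [show (- (c⁻¹ : ℝ) * (‖w‖ : ℂ) ^ 2 + 2 * Real.pi * I * ((0 : ℝ) : ℂ)) =
        ((-c⁻¹ * ‖w‖ ^ 2 : ℝ) : ℂ) by push_cast; ring, ← Complex.ofReal_exp, Complex.re_ofReal_mul]
    have h5 : ∫ w : ℝ, Real.exp (-c⁻¹ * ‖w‖ ^ 2) * (FourierTransform.fourier u w).re =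
        (∫ w : ℝ, cexp (- c⁻¹ * ‖w‖ ^ 2 + 2 * Real.pi * I * (inner ℝ (0 : ℝ) w : ℝ)) •
          FourierTransform.fourier u w).re := by
      simp_rw [h4]
      obtain ⟨C, hC⟩ := hbound
      have hJ : Integrable fun w : ℝ =>
          cexp (- c⁻¹ * ‖w‖ ^ 2 + 2 * Real.pi * I * (inner ℝ (0 : ℝ) w : ℝ)) •
            FourierTransform.fourier u w :=
        J.mul_bdd (c := C) hF.aestronglyMeasurable (ae_of_all _ hC)
      exact integral_re hJ
    rw [h5, Function.comp_apply]
    congr 1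
    refine Eq.trans ?_ h3
    refine integral_congr_ae (ae_of_all _ fun w => ?_)
    have e1 : (Real.pi / ((c⁻¹ : ℝ) : ℂ)) = Real.pi * c := by simp
    have e2 : -(Real.pi : ℂ) ^ 2 * (‖(0 : ℝ) - w‖ : ℂ) ^ 2 / ((c⁻¹ : ℝ) : ℂ) =
        -(Real.pi : ℂ) ^ 2 * c * (‖(0 : ℝ) - w‖ : ℂ) ^ 2 := by
      rw [Complex.ofReal_inv, div_inv_eq_mul]; ring
    beta_reduce
    rw [fourier_gaussian_innerProductSpace' (by simpa), e1, e2]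
  -- The weights increase with `c` and the transform is nonnegative, so the integral at `c = 1` is
  -- at most the limit.
  have hone : ∫ w : ℝ, Real.exp (-(1:ℝ)⁻¹ * ‖w‖ ^ 2) * (FourierTransform.fourier u w).re ≤ 0 := by
    refine ge_of_tendsto hlim ?_
    filter_upwards [eventually_ge_atTop 1] with c hc
    refine integral_mono (hint 1 one_pos) (hint c (by linarith)) fun w => ?_
    refine mul_le_mul_of_nonneg_right (Real.exp_le_exp.2 ?_) (Complex.nonneg_iff.1 (hpos w)).1
    refine mul_le_mul_of_nonneg_right ?_ (by positivity)
    simpa using inv_le_one_of_one_le₀ hc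
  have hnn : ∀ w : ℝ, 0 ≤ Real.exp (-(1:ℝ)⁻¹ * ‖w‖ ^ 2) * (FourierTransform.fourier u w).re :=
    fun w => mul_nonneg (Real.exp_pos _).le (Complex.nonneg_iff.1 (hpos w)).1
  have hz := (integral_eq_zero_iff_of_nonneg hnn (hint 1 one_pos)).1
    (le_antisymm hone (integral_nonneg hnn))
  have hz' := Continuous.ae_eq_iff_eq volume (by
    have := Complex.continuous_re.comp hF
    simp only [Function.comp_def] at this
    fun_prop) continuous_const |>.1 hz
  have h6 := congrFun hz' τ
  have h7 : (FourierTransform.fourier u τ).re = 0 :=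
    (mul_eq_zero.1 h6).resolve_left (Real.exp_ne_zero _)
  exact Complex.ext h7 (Complex.nonneg_iff.1 (hpos τ)).2.symm

/-! ### Radon transform and Fourier slices -/

/-- Coordinates of the plane along `p` and its rotation by a right angle. -/
noncomputable def rotatedPoint (p : Plane) (z : ℝ × ℝ) : Plane :=
  !₂[z.1 * p 0 - z.2 * p 1, z.1 * p 1 + z.2 * p 0]

lemma continuous_rotatedPoint (p : Plane) : Continuous (rotatedPoint p) := by
  unfold rotatedPoint
  refine (PiLp.continuous_toLp 2 _).comp (continuous_pi fun i => ?_)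
  fin_cases i <;> simp <;> fun_prop

lemma sq_add_sq_of_norm_eq_one {p : Plane} (hp : ‖p‖ = 1) : p 0 ^ 2 + p 1 ^ 2 = 1 := by
  have := EuclideanSpace.real_norm_sq_eq p
  rw [hp, Fin.sum_univ_two] at this
  linarith

lemma norm_sq_rotatedPoint {p : Plane} (hp : ‖p‖ = 1) (z : ℝ × ℝ) :
    ‖rotatedPoint p z‖ ^ 2 = z.1 ^ 2 + z.2 ^ 2 := by
  have h := sq_add_sq_of_norm_eq_one hp
  rw [EuclideanSpace.real_norm_sq_eq, Fin.sum_univ_two]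
  simp only [rotatedPoint, PiLp.toLp_apply, Matrix.cons_val_zero, Matrix.cons_val_one]
  linear_combination (z.1 ^ 2 + z.2 ^ 2) * h

lemma inner_rotatedPoint {p : Plane} (hp : ‖p‖ = 1) (z : ℝ × ℝ) :
    inner ℝ (rotatedPoint p z) p = z.1 := by
  have h := sq_add_sq_of_norm_eq_one hp
  rw [PiLp.inner_apply, Fin.sum_univ_two]
  simp only [rotatedPoint, PiLp.toLp_apply, Matrix.cons_val_zero, Matrix.cons_val_one,
    RCLike.inner_apply, conj_trivial]
  linear_combination z.1 * h

lemma measurePreserving_rotatedPoint {p : Plane} (hp : ‖p‖ = 1) :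
    MeasurePreserving (rotatedPoint p) := by
  have h := sq_add_sq_of_norm_eq_one hp
  let M : Matrix (Fin 2) (Fin 2) ℝ := !![p 0, -p 1; p 1, p 0]
  have hdet : M.det = 1 := by
    rw [Matrix.det_fin_two_of]; linarith
  have hM : MeasurePreserving (Matrix.toLin' M) (volume : Measure (Fin 2 → ℝ)) volume := by
    refine ⟨(LinearMap.continuous_of_finiteDimensional _).measurable, ?_⟩
    rw [Real.map_matrix_volume_pi_eq_smul_volume_pi (by simp [hdet]), hdet]
    simp
  have := (PiLp.volume_preserving_toLp (Fin 2)).comp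
    (hM.comp ((volume_preserving_finTwoArrow ℝ).symm _))
  have key : rotatedPoint p =
      WithLp.toLp 2 ∘ Matrix.toLin' M ∘ MeasurableEquiv.finTwoArrow.symm := by
    funext z
    ext i
    fin_cases i
    · simp [rotatedPoint, M]; ring
    · simp [rotatedPoint, M]
  rw [key]
  exact this

lemma abs_le_of_apply_rotatedPoint_ne_zero {p : Plane} (hp : ‖p‖ = 1) {w : Plane → ℂ} {C : ℝ}
    (hC : ∀ x, w x ≠ 0 → ‖x‖ ≤ C) {z : ℝ × ℝ} (hz : w (rotatedPoint p z) ≠ 0) :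
    |z.1| ≤ C ∧ |z.2| ≤ C := by
  have h1 := hC _ hz
  have h0 : 0 ≤ C := (norm_nonneg _).trans h1
  have h2 : z.1 ^ 2 + z.2 ^ 2 ≤ C ^ 2 := by
    rw [← norm_sq_rotatedPoint hp]
    gcongr
  exact ⟨abs_le_of_sq_le_sq (by nlinarith [sq_nonneg z.2]) h0,
    abs_le_of_sq_le_sq (by nlinarith [sq_nonneg z.1]) h0⟩

lemma exists_norm_bound_of_hasCompactSupport {w : Plane → ℂ} (hs : HasCompactSupport w) :
    ∃ C, ∀ x, w x ≠ 0 → ‖x‖ ≤ C := by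
  obtain ⟨C, hC⟩ := hs.isCompact.isBounded.exists_norm_le
  exact ⟨C, fun x hx => hC x (subset_tsupport _ hx)⟩

lemma continuous_radon {p : Plane} (hp : ‖p‖ = 1) {w : Plane → ℂ} (hw : Continuous w)
    (hs : HasCompactSupport w) : Continuous (radon p w) := by
  obtain ⟨C, hC⟩ := exists_norm_bound_of_hasCompactSupport hs
  have h1 : radon p w = fun t => ∫ s in Set.Icc (-C) C, w (rotatedPoint p (t, s)) := by
    funext t
    exact (setIntegral_eq_integral_of_forall_compl_eq_zero fun s hs => by_contra fun hne =>
      hs (abs_le.1 (abs_le_of_apply_rotatedPoint_ne_zero hp hC (z := (t, s)) hne).2)).symm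
  rw [h1]
  exact continuous_parametric_integral_of_continuous (f := fun t s => w (rotatedPoint p (t, s)))
    (hw.comp (continuous_rotatedPoint p)) isCompact_Icc

lemma hasCompactSupport_radon {p : Plane} (hp : ‖p‖ = 1) {w : Plane → ℂ}
    (hs : HasCompactSupport w) : HasCompactSupport (radon p w) := by
  obtain ⟨C, hC⟩ := exists_norm_bound_of_hasCompactSupport hs
  refine HasCompactSupport.intro (isCompact_Icc (a := -C) (b := C)) fun t ht => ?_
  have : ∀ s, w (rotatedPoint p (t, s)) = 0 := fun s => by_contra fun hne =>
    ht (abs_le.1 (abs_le_of_apply_rotatedPoint_ne_zero hp hC (z := (t, s)) hne).1)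
  change ∫ s, w (rotatedPoint p (t, s)) = 0
  simp [this]

/-- The Fourier slice theorem. -/
lemma fourier_radon {p : Plane} (hp : ‖p‖ = 1) {w : Plane → ℂ} (hw : Continuous w)
    (hs : HasCompactSupport w) (τ : ℝ) :
    FourierTransform.fourier (radon p w) τ = fourierPlane w ((2 * Real.pi * τ) • p) := by
  have hT := measurePreserving_rotatedPoint hp
  have hc : Continuous fun x => w x * planeChar ((2 * Real.pi * τ) • p) x :=
    hw.mul (continuous_planeChar _)
  have hint : Integrable fun x => w x * planeChar ((2 * Real.pi * τ) • p) x :=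
    hc.integrable_of_hasCompactSupport hs.mul_right
  have hint2 : Integrable fun z : ℝ × ℝ =>
      w (rotatedPoint p z) * planeChar ((2 * Real.pi * τ) • p) (rotatedPoint p z) :=
    (hT.integrable_comp hc.aestronglyMeasurable).2 hint
  -- Fubini in the rotated coordinates, where the character depends only on the first one.
  rw [fourierPlane_eq, ← hT.map_eq, integral_map hT.aemeasurable hc.aestronglyMeasurable,
    Measure.volume_eq_prod, integral_prod _ (by rwa [← Measure.volume_eq_prod]),
    Real.fourier_real_eq_integral_exp_smul]
  refine integral_congr_ae (ae_of_all _ fun t => ?_)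
  simp only [radon]
  rw [smul_eq_mul, ← integral_const_mul]
  refine integral_congr_ae (ae_of_all _ fun s => ?_)
  simp only [planeChar, inner_smul_right, inner_rotatedPoint hp]
  rw [mul_comm]
  congr 2
  push_cast; ring

/-! ### Locally finite lattice sums -/

/-- The integer points of a square about the origin. -/
noncomputable def latticeBox (r : ℝ) : Finset (ℤ × ℤ) :=
  Finset.Icc (-⌈r⌉) ⌈r⌉ ×ˢ Finset.Icc (-⌈r⌉) ⌈r⌉

lemma mem_latticeBox_of_norm_le {k : ℤ × ℤ} {r : ℝ} (h : ‖latticePoint k‖ ≤ r) :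
    k ∈ latticeBox r := by
  have h0 := (PiLp.norm_apply_le (latticePoint k) 0).trans (h.trans (Int.le_ceil r))
  have h1 := (PiLp.norm_apply_le (latticePoint k) 1).trans (h.trans (Int.le_ceil r))
  simp only [latticePoint, PiLp.toLp_apply, Matrix.cons_val_zero, Matrix.cons_val_one,
    Real.norm_eq_abs, abs_le] at h0 h1
  simp only [latticeBox, Finset.mem_product, Finset.mem_Icc]
  exact_mod_cast And.intro h0 h1

/-- Near a given point a locally finite lattice sum is a fixed finite sum. -/
lemma apply_eq_sum_latticeBox {φ h : Plane → ℂ} {c : ℤ × ℤ → ℂ} {C r : ℝ}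
    (hC : ∀ x, φ x ≠ 0 → ‖x‖ ≤ C)
    (hsum : ∀ x, HasSum (fun k => c k * φ (x - latticePoint k)) (h x)) {x : Plane} (hx : ‖x‖ ≤ r) :
    h x = ∑ k ∈ latticeBox (r + C), c k * φ (x - latticePoint k) := by
  refine (hsum x).unique (hasSum_sum_of_ne_finset_zero fun k hk => ?_)
  by_contra hne
  apply hk
  refine mem_latticeBox_of_norm_le ?_
  have h1 := hC _ (right_ne_zero_of_mul hne)
  have h2 : latticePoint k = x - (x - latticePoint k) := by abel
  rw [h2]
  exact (norm_sub_le _ _).trans (add_le_add hx h1)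

lemma continuous_of_hasSum_lattice {φ h : Plane → ℂ} {c : ℤ × ℤ → ℂ} {C : ℝ}
    (hφ : Continuous φ) (hC : ∀ x, φ x ≠ 0 → ‖x‖ ≤ C)
    (hsum : ∀ x, HasSum (fun k => c k * φ (x - latticePoint k)) (h x)) : Continuous h := by
  rw [continuous_iff_continuousAt]
  intro x₀
  have h1 : Continuous fun x => ∑ k ∈ latticeBox (‖x₀‖ + 1 + C), c k * φ (x - latticePoint k) := by
    fun_prop
  refine h1.continuousAt.congr ?_
  filter_upwards [Metric.ball_mem_nhds x₀ one_pos] with x hx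
  refine (apply_eq_sum_latticeBox hC hsum ?_).symm
  have h2 : x = x₀ + (x - x₀) := by abel
  rw [h2]
  refine (norm_add_le _ _).trans ?_
  have := mem_ball_iff_norm.1 hx
  linarith

/-! ### Correlations with integer translates -/

/-- The correlation of `f` with the integer translates of `g`. -/
noncomputable def latticeCorrelation (f g : Plane → ℂ) (k : ℤ × ℤ) : ℂ :=
  ∫ x, f x * starRingEnd ℂ (g (x - latticePoint k))

lemma hasCompactSupport_comp_sub {f : Plane → ℂ} (hf : HasCompactSupport f) (a : Plane) :
    HasCompactSupport fun x => f (x - a) :=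
  hf.comp_homeomorph (Homeomorph.subRight a)

lemma integrable_mul_conj_translate {f g : Plane → ℂ} (hf : Continuous f)
    (hfs : HasCompactSupport f) (hg : Continuous g) (a b : Plane) :
    Integrable fun x => f (x - a) * starRingEnd ℂ (g (x - b)) := by
  refine Continuous.integrable_of_hasCompactSupport ?_ (hasCompactSupport_comp_sub hfs a).mul_right
  have := Complex.continuous_conj
  exact (hf.comp (continuous_id.sub continuous_const)).mul
    (this.comp (hg.comp (continuous_id.sub continuous_const)))

lemma integral_translate_mul_conj_translate (f g : Plane → ℂ) (j k : ℤ × ℤ) :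
    ∫ x, f (x - latticePoint j) * starRingEnd ℂ (g (x - latticePoint k)) =
      latticeCorrelation f g (k - j) := by
  rw [latticeCorrelation, ← integral_sub_right_eq_self
    (fun x => f x * starRingEnd ℂ (g (x - latticePoint (k - j)))) (latticePoint j)]
  refine integral_congr_ae (ae_of_all _ fun x => ?_)
  simp only [latticePoint_sub]
  congr 3
  abel

lemma latticeCorrelation_eq_zero {φ : Plane → ℂ} {C : ℝ} (hC : ∀ x, φ x ≠ 0 → ‖x‖ ≤ C)
    {m : ℤ × ℤ} (hm : m ∉ latticeBox (C + C)) : latticeCorrelation φ φ m = 0 := by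
  have : ∀ x, φ x * starRingEnd ℂ (φ (x - latticePoint m)) = 0 := by
    intro x
    by_contra hne
    apply hm
    refine mem_latticeBox_of_norm_le ?_
    have h1 := hC _ (left_ne_zero_of_mul hne)
    have h2 := hC (x - latticePoint m) fun h0 => hne (by simp [h0])
    have h3 : latticePoint m = x - (x - latticePoint m) := by abel
    rw [h3]
    exact (norm_sub_le _ _).trans (add_le_add h1 h2)
  simp [latticeCorrelation, this]

/-- Only translates overlapping `φ(· - k)` contribute, so the sum is finite without any support
condition on `h` or `c`. -/
lemma latticeCorrelation_eq_sum {φ h : Plane → ℂ} {c : ℤ × ℤ → ℂ} {C : ℝ}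
    (hφ : Continuous φ) (hφs : HasCompactSupport φ) (hC : ∀ x, φ x ≠ 0 → ‖x‖ ≤ C)
    (hsum : ∀ x, HasSum (fun k => c k * φ (x - latticePoint k)) (h x)) (k : ℤ × ℤ) :
    latticeCorrelation h φ k =
      ∑ m ∈ latticeBox (C + C), latticeCorrelation φ φ m * c (k - m) := by
  have hpt : ∀ y, h y * starRingEnd ℂ (φ (y - latticePoint k)) =
      ∑ m ∈ latticeBox (C + C), c (k - m) *
        (φ (y - latticePoint (k - m)) * starRingEnd ℂ (φ (y - latticePoint k))) := by
    intro y
    by_cases h0 : φ (y - latticePoint k) = 0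
    · simp [h0]
    have h1 : HasSum (fun m => c (k - m) * φ (y - latticePoint (k - m))) (h y) :=
      (Equiv.subLeft k).hasSum_iff.2 (hsum y)
    have h2 : h y = ∑ m ∈ latticeBox (C + C), c (k - m) * φ (y - latticePoint (k - m)) := by
      refine h1.unique (hasSum_sum_of_ne_finset_zero fun m hm => ?_)
      by_contra hne
      apply hm
      refine mem_latticeBox_of_norm_le ?_
      have h3 : latticePoint m = (y - latticePoint (k - m)) - (y - latticePoint k) := by
        rw [latticePoint_sub]; abel
      rw [h3]
      exact (norm_sub_le _ _).trans (add_le_add (hC _ (right_ne_zero_of_mul hne)) (hC _ h0))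
    rw [h2, Finset.sum_mul]
    exact Finset.sum_congr rfl fun m _ => by ring
  rw [latticeCorrelation]
  simp_rw [hpt]
  rw [integral_finsetSum]
  · refine Finset.sum_congr rfl fun m _ => ?_
    rw [integral_const_mul, integral_translate_mul_conj_translate, mul_comm]
    congr 2; abel
  · exact fun m _ => (integrable_mul_conj_translate hφ hφs hφ _ _).const_mul _

/-- A lattice sum filtered by the autocorrelation of its generator is the lattice sum whose
coefficients are the correlations with the generator. -/
lemma sum_autocorrelation_mul_translate {φ h : Plane → ℂ} {c : ℤ × ℤ → ℂ} {C : ℝ}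
    (hφ : Continuous φ) (hφs : HasCompactSupport φ) (hC : ∀ x, φ x ≠ 0 → ‖x‖ ≤ C)
    (hsum : ∀ x, HasSum (fun k => c k * φ (x - latticePoint k)) (h x)) (E : Finset (ℤ × ℤ))
    (hE : ∀ k ∉ E, latticeCorrelation h φ k = 0) (x : Plane) :
    ∑ m ∈ latticeBox (C + C), latticeCorrelation φ φ m * h (x - latticePoint m) =
      ∑ k ∈ E, latticeCorrelation h φ k * φ (x - latticePoint k) := by
  have h1 : ∀ m, HasSum (fun k => latticeCorrelation φ φ m * (c (k - m) * φ (x - latticePoint k)))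
      (latticeCorrelation φ φ m * h (x - latticePoint m)) := by
    intro m
    refine HasSum.mul_left _ ?_
    have := (Equiv.subRight m).hasSum_iff.2 (hsum (x - latticePoint m))
    refine this.congr_fun fun k => ?_
    simp [latticePoint_sub]
  have h2 := hasSum_sum (s := latticeBox (C + C)) fun m _ => h1 m
  refine h2.unique ?_
  have h3 : (fun k => ∑ m ∈ latticeBox (C + C),
      latticeCorrelation φ φ m * (c (k - m) * φ (x - latticePoint k))) =
      fun k => latticeCorrelation h φ k * φ (x - latticePoint k) := by
    funext k
    rw [latticeCorrelation_eq_sum hφ hφs hC hsum k, Finset.sum_mul]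
    exact Finset.sum_congr rfl fun m _ => by ring
  rw [h3]
  exact hasSum_sum_of_ne_finset_zero fun k hk => by rw [hE k hk, zero_mul]

lemma fourierPlane_sum_translate {κ : Type*} (A : Finset κ) (a : κ → ℂ) (y : κ → Plane)
    {w : Plane → ℂ} (hw : Continuous w) (hs : HasCompactSupport w) (ξ : Plane) :
    fourierPlane (fun x => ∑ k ∈ A, a k * w (x - y k)) ξ =
      (∑ k ∈ A, a k * planeChar ξ (y k)) * fourierPlane w ξ := by
  simp only [fourierPlane_eq, Finset.sum_mul]
  rw [integral_finsetSum]
  · refine Finset.sum_congr rfl fun k _ => ?_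
    rw [← integral_const_mul, ← integral_sub_right_eq_self
      (fun x => a k * planeChar ξ (y k) * (w x * planeChar ξ x)) (y k)]
    refine integral_congr_ae (ae_of_all _ fun x => ?_)
    have : planeChar ξ x = planeChar ξ (y k) * planeChar ξ (x - y k) := by
      rw [← planeChar_add]; congr 1; abel
    simp only [this]
    ring
  · intro k _
    refine Continuous.integrable_of_hasCompactSupport ?_ ?_
    · have := continuous_planeChar ξ
      fun_prop
    · exact ((hasCompactSupport_comp_sub hs (y k)).mul_left).mul_right

/-- Modulating `φ` absorbs the character into the correlation. The quadratic forms over squares then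
become squared `L²` norms, and Fejér averaging applies. -/
lemma sum_autocorrelation_nonneg {φ : Plane → ℂ} {C : ℝ} (hφ : Continuous φ)
    (hφs : HasCompactSupport φ) (hC : ∀ x, φ x ≠ 0 → ‖x‖ ≤ C) (ξ : Plane) :
    0 ≤ ∑ m ∈ latticeBox (C + C), latticeCorrelation φ φ m * planeChar ξ (latticePoint m) := by
  let q : Plane → ℂ := fun x => φ x * planeChar ξ x
  have hq : Continuous q := hφ.mul (continuous_planeChar ξ)
  have hqs : HasCompactSupport q := hφs.mul_right
  have hcor : ∀ m, latticeCorrelation φ φ m * planeChar ξ (latticePoint m) =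
      latticeCorrelation q q m := by
    intro m
    rw [latticeCorrelation, latticeCorrelation, ← integral_mul_const]
    refine integral_congr_ae (ae_of_all _ fun x => ?_)
    have h1 : planeChar ξ x = planeChar ξ (latticePoint m) * planeChar ξ (x - latticePoint m) := by
      rw [← planeChar_add]; congr 1; abel
    have h2 : planeChar ξ (x - latticePoint m) *
        starRingEnd ℂ (planeChar ξ (x - latticePoint m)) = 1 := by
      rw [← planeChar_neg, ← planeChar_add, add_neg_cancel, planeChar_zero]
    simp only [q, map_mul, h1]
    linear_combination (-φ x * starRingEnd ℂ (φ (x - latticePoint m)) *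
      planeChar ξ (latticePoint m)) * h2
  refine sum_nonneg_of_latticeSquare_form_nonneg _ _
    (fun m hm => by rw [latticeCorrelation_eq_zero hC hm, zero_mul]) fun n => ?_
  have h3 : ∑ j ∈ latticeSquare n, ∑ k ∈ latticeSquare n,
      latticeCorrelation φ φ (j - k) * planeChar ξ (latticePoint (j - k)) =
      ((∫ x, ‖∑ k ∈ latticeSquare n, q (x - latticePoint k)‖ ^ 2 : ℝ) : ℂ) := by
    rw [← integral_complex_ofReal]
    simp_rw [hcor, ← integral_translate_mul_conj_translate]
    have hi := fun j k : ℤ × ℤ =>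
      integrable_mul_conj_translate hq hqs hq (latticePoint k) (latticePoint j)
    rw [Finset.sum_congr rfl fun j _ => (integral_finsetSum _ fun k _ => hi j k).symm,
      ← integral_finsetSum _ fun j _ => integrable_finsetSum _ fun k _ => hi j k]
    refine integral_congr_ae (ae_of_all _ fun x => ?_)
    simp only [Complex.ofReal_pow]
    rw [← Complex.mul_conj', map_sum, Finset.sum_mul_sum, Finset.sum_comm]
  rw [h3]
  exact_mod_cast integral_nonneg fun x => by positivity

/-! ### Exponential sums along a line -/

lemma planeChar_smul (τ : ℝ) (p x : Plane) :
    planeChar (τ • p) x = cexp (-(I * ((τ * inner ℝ x p : ℝ) : ℂ))) := by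
  rw [planeChar, inner_smul_right]

lemma analyticOnNhd_sum_planeChar {κ : Type*} (A : Finset κ) (a : κ → ℂ) (y : κ → Plane)
    (p : Plane) :
    AnalyticOnNhd ℝ (fun τ : ℝ => ∑ k ∈ A, a k * planeChar (τ • p) (y k)) Set.univ := by
  intro τ _
  simp only [planeChar_smul]
  refine Finset.analyticAt_fun_sum _ fun k _ => analyticAt_const.mul ?_
  have h1 : AnalyticAt ℝ (fun τ : ℝ => -(I * ((τ * inner ℝ (y k) p : ℝ) : ℂ))) τ := by
    refine (analyticAt_const.mul ?_).neg
    exact (Complex.ofRealCLM.analyticAt _).comp (analyticAt_id.mul analyticAt_const)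
  exact (analyticAt_cexp.restrictScalars (𝕜 := ℝ)).comp h1

/-- Exponential sums with distinct frequencies are determined by their germ at the origin. -/
lemma coeff_eq_zero_of_sum_planeChar_eventually_eq_zero {κ : Type*} (A : Finset κ) (a : κ → ℂ)
    (y : κ → Plane) (p : Plane) (hinj : Set.InjOn (fun k => inner ℝ (y k) p) (A : Set κ))
    (h : ∀ᶠ τ in 𝓝 (0 : ℝ), ∑ k ∈ A, a k * planeChar (τ • p) (y k) = 0) :
    ∀ k ∈ A, a k = 0 := by
  have hzero : ∀ τ : ℝ, ∑ k ∈ A, a k * planeChar (τ • p) (y k) = 0 := fun τ =>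
    (analyticOnNhd_sum_planeChar A a y p).eqOn_zero_of_preconnected_of_eventuallyEq_zero
      isPreconnected_univ (Set.mem_univ 0) h (Set.mem_univ τ)
  -- The exponentials become monoid homomorphisms, so that Dedekind's independence of characters
  -- applies.
  let χ : A → (Multiplicative ℝ →* ℂ) := fun k =>
    { toFun := fun τ => cexp (-(I * ((τ.toAdd * inner ℝ (y k) p : ℝ) : ℂ)))
      map_one' := by simp
      map_mul' := fun s t => by
        rw [← Complex.exp_add]; congr 1; rw [toAdd_mul]; push_cast; ring }
  have hχ : Function.Injective χ := by
    intro k l hkl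
    -- The derivative at the origin recovers the frequency.
    have h1 : ∀ r : ℝ, HasDerivAt (fun τ : ℝ => cexp (-(I * ((τ * r : ℝ) : ℂ)))) (-(I * r)) 0 := by
      intro r
      have h2 : HasDerivAt (fun τ : ℝ => -(I * ((τ * r : ℝ) : ℂ))) (-(I * r)) 0 := by
        have := (((hasDerivAt_id (0 : ℝ)).mul_const r).ofReal_comp.const_mul I).neg
        exact this.congr_deriv (by simp)
          |>.congr_of_eventuallyEq (Eventually.of_forall fun τ => by simp)
      simpa using h2.cexp
    have h3 : (fun τ : ℝ => cexp (-(I * ((τ * inner ℝ (y k) p : ℝ) : ℂ)))) =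
        fun τ : ℝ => cexp (-(I * ((τ * inner ℝ (y l) p : ℝ) : ℂ))) := by
      funext τ
      exact DFunLike.congr_fun hkl (Multiplicative.ofAdd τ)
    have h4 := (h1 (inner ℝ (y k) p)).unique (h3 ▸ h1 (inner ℝ (y l) p))
    have h5 : inner ℝ (y k) p = inner ℝ (y l) p := by
      have := mul_left_cancel₀ I_ne_zero (neg_injective h4)
      exact_mod_cast this
    exact Subtype.ext (hinj k.2 l.2 h5)
  have hli := (linearIndependent_monoidHom (Multiplicative ℝ) ℂ).comp χ hχ
  rw [Fintype.linearIndependent_iff] at hli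
  intro k hk
  refine hli (fun k => a k) ?_ ⟨k, hk⟩
  funext τ
  have := hzero τ.toAdd
  simp only [planeChar_smul] at this
  rw [← Finset.sum_coe_sort] at this
  simpa [χ, Finset.sum_apply] using this

/-! ### Radon samples and transforms along a direction -/

lemma rotatedPoint_zero_add {p : Plane} (hp : ‖p‖ = 1) (y : Plane) (s : ℝ) :
    rotatedPoint p (0, s) + y =
      rotatedPoint p (inner ℝ p y, s + (y 1 * p 0 - y 0 * p 1)) := by
  have h := sq_add_sq_of_norm_eq_one hp
  ext i
  fin_cases i
  · simp [rotatedPoint, PiLp.inner_apply, Fin.sum_univ_two]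
    linear_combination -y 0 * h
  · simp [rotatedPoint, PiLp.inner_apply, Fin.sum_univ_two]
    linear_combination -y 1 * h

lemma integrable_line {p : Plane} (hp : ‖p‖ = 1) {w : Plane → ℂ} (hw : Continuous w)
    (hs : HasCompactSupport w) (t : ℝ) : Integrable fun s => w (rotatedPoint p (t, s)) := by
  obtain ⟨C, hC⟩ := exists_norm_bound_of_hasCompactSupport hs
  refine Continuous.integrable_of_hasCompactSupport
    (hw.comp ((continuous_rotatedPoint p).comp (by fun_prop)))
    (HasCompactSupport.intro (isCompact_Icc (a := -C) (b := C)) fun s hs => ?_)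
  by_contra hne
  exact hs (abs_le.1 (abs_le_of_apply_rotatedPoint_ne_zero hp hC (z := (t, s)) hne).2)

/-- Translation by `y` carries the line at offset `0` to the one at offset `p·y`. The remaining
shift along the line does not affect the integral. -/
lemma radon_sum_translate_zero {κ : Type*} (A : Finset κ) (a : κ → ℂ) (y : κ → Plane) {p : Plane}
    (hp : ‖p‖ = 1) {w : Plane → ℂ} (hw : Continuous w) (hs : HasCompactSupport w) :
    radon p (fun x => ∑ k ∈ A, a k * w (x + y k)) 0 =
      ∑ k ∈ A, a k * radon p w (inner ℝ p (y k)) := by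
  change ∫ s, ∑ k ∈ A, a k * w (rotatedPoint p (0, s) + y k) = _
  simp_rw [rotatedPoint_zero_add hp]
  rw [integral_finsetSum]
  · refine Finset.sum_congr rfl fun k _ => ?_
    rw [integral_const_mul]
    congr 1
    exact integral_add_right_eq_self
      (fun s => w (rotatedPoint p (inner ℝ p (y k), s))) (y k 1 * p 0 - y k 0 * p 1)
  · intro k _
    exact ((integrable_line hp hw hs (inner ℝ p (y k))).comp_add_right _).const_mul _

lemma continuous_fourierPlane_smul {p : Plane} (hp : ‖p‖ = 1) {w : Plane → ℂ} (hw : Continuous w)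
    (hs : HasCompactSupport w) : Continuous fun τ : ℝ => fourierPlane w (τ • p) := by
  have hu : Integrable (radon p w) :=
    (continuous_radon hp hw hs).integrable_of_hasCompactSupport (hasCompactSupport_radon hp hs)
  have hF : Continuous (FourierTransform.fourier (radon p w)) :=
    VectorFourier.fourierIntegral_continuous Real.continuous_fourierChar
      (by exact continuous_inner) hu
  have h1 : (fun τ : ℝ => fourierPlane w (τ • p)) =
      fun τ => FourierTransform.fourier (radon p w) (τ / (2 * Real.pi)) := by
    funext τ
    rw [fourier_radon hp hw hs, mul_div_cancel₀ _ (by positivity)]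
  rw [h1]
  exact hF.comp (by fun_prop)

/-- A continuous compactly supported function whose Fourier transform is nonnegative on the line
spanned by the unit vector `p` and whose Radon transform in direction `p` vanishes at the origin
has a Fourier transform vanishing on that line. -/
lemma fourierPlane_smul_eq_zero_of_nonneg {p : Plane} (hp : ‖p‖ = 1) {w : Plane → ℂ}
    (hw : Continuous w) (hs : HasCompactSupport w)
    (hpos : ∀ τ : ℝ, 0 ≤ fourierPlane w (τ • p)) (h0 : radon p w 0 = 0) (τ : ℝ) :
    fourierPlane w (τ • p) = 0 := by
  have h := fourier_eq_zero_of_nonneg_of_apply_zero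
    ((continuous_radon hp hw hs).integrable_of_hasCompactSupport (hasCompactSupport_radon hp hs))
    (continuous_radon hp hw hs) (fun τ => by rw [fourier_radon hp hw hs]; exact hpos _) h0
    (τ / (2 * Real.pi))
  rwa [fourier_radon hp hw hs, mul_div_cancel₀ _ (by positivity)] at h

/-! ### Vanishing of the correlations and of the function -/

lemma latticeCorrelation_eq_zero_of_radon_eq_zero {φ h : Plane → ℂ} {c : ℤ × ℤ → ℂ}
    (hφ : Continuous φ) (hφs : HasCompactSupport φ) (hpos : ∀ ξ, 0 ≤ fourierPlane φ ξ)
    (hφ0 : fourierPlane φ 0 ≠ 0) (hhs : HasCompactSupport h)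
    (hsum : ∀ x, HasSum (fun k => c k * φ (x - latticePoint k)) (h x)) (E : Finset (ℤ × ℤ))
    (hE : ∀ k ∉ E, latticeCorrelation h φ k = 0) {p : Plane} (hp : ‖p‖ = 1)
    (hinj : Set.InjOn (fun k => inner ℝ (latticePoint k) p) (E : Set (ℤ × ℤ)))
    (hrad : ∀ k ∈ E, radon p h (inner ℝ p (latticePoint k)) = 0) (k : ℤ × ℤ) :
    latticeCorrelation h φ k = 0 := by
  obtain ⟨C, hC⟩ := exists_norm_bound_of_hasCompactSupport hφs
  have hh : Continuous h := continuous_of_hasSum_lattice hφ hC hsum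
  let G : Plane → ℂ := fun ξ =>
    ∑ m ∈ latticeBox (C + C), latticeCorrelation φ φ m * planeChar ξ (latticePoint m)
  let D : Plane → ℂ := fun ξ => ∑ k ∈ E, latticeCorrelation h φ k * planeChar ξ (latticePoint k)
  have hGD : ∀ ξ, G ξ * fourierPlane h ξ = D ξ * fourierPlane φ ξ := by
    intro ξ
    rw [← fourierPlane_sum_translate _ _ _ hh hhs, ← fourierPlane_sum_translate _ _ _ hφ hφs]
    congr 1
    funext x
    exact sum_autocorrelation_mul_translate hφ hφs hC hsum E hE x
  -- The conjugated coefficients turn `D` into `|D|²` below, while the shifts `+k` make `R_p w(0)` a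
  -- combination of the samples.
  let w : Plane → ℂ := fun x =>
    ∑ k ∈ E, starRingEnd ℂ (latticeCorrelation h φ k) * h (x + latticePoint k)
  have hw : Continuous w := by fun_prop
  have hws : HasCompactSupport w := by
    have : w = ∑ k ∈ E, fun x => starRingEnd ℂ (latticeCorrelation h φ k) *
        h (x + latticePoint k) := by
      funext x; simp [w]
    rw [this]
    refine Finset.sum_induction _ HasCompactSupport (fun _ _ => HasCompactSupport.add)
      HasCompactSupport.zero fun k _ => ?_
    exact (hhs.comp_homeomorph (Homeomorph.addRight (latticePoint k))).mul_left
  have hwF : ∀ ξ, fourierPlane w ξ = starRingEnd ℂ (D ξ) * fourierPlane h ξ := by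
    intro ξ
    have := fourierPlane_sum_translate E (fun k => starRingEnd ℂ (latticeCorrelation h φ k))
      (fun k => -latticePoint k) hh hhs ξ
    simp only [sub_neg_eq_add, planeChar_neg, ← map_mul, ← map_sum] at this
    exact this
  have hGw : ∀ ξ, G ξ * fourierPlane w ξ = (‖D ξ‖ ^ 2 : ℝ) * fourierPlane φ ξ := by
    intro ξ
    rw [hwF, Complex.ofReal_pow, ← Complex.mul_conj']
    linear_combination starRingEnd ℂ (D ξ) * hGD ξ
  have hprod : ∀ τ : ℝ, G (τ • p) * fourierPlane w (τ • p) = 0 := by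
    by_cases hG : ∀ τ : ℝ, G (τ • p) = 0
    · intro τ; rw [hG, zero_mul]
    suffices hz : ∀ τ : ℝ, fourierPlane w (τ • p) = 0 by intro τ; rw [hz, mul_zero]
    refine fourierPlane_smul_eq_zero_of_nonneg hp hw hws (fun τ => ?_) ?_
    · have hana := analyticOnNhd_sum_planeChar (latticeBox (C + C)) (latticeCorrelation φ φ)
        latticePoint p
      -- By analyticity `G` is either zero near `τ`, hence on the whole line, or nonzero on a
      -- punctured neighbourhood. In the second case the sign of `fourierPlane w` at `τ` follows by
      -- a limit.
      rcases (hana τ (Set.mem_univ _)).eventually_eq_zero_or_eventually_ne_zero with h0 | h0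
      · exact absurd (fun σ => hana.eqOn_zero_of_preconnected_of_eventuallyEq_zero
          isPreconnected_univ (Set.mem_univ τ) h0 (Set.mem_univ σ)) hG
      · refine ge_of_tendsto ((continuous_fourierPlane_smul hp hw hws).continuousAt.tendsto.mono_left
          (nhdsWithin_le_nhds (s := {τ}ᶜ))) ?_
        filter_upwards [h0] with σ hσ
        have h1 : 0 < G (σ • p) :=
          lt_of_le_of_ne (sum_autocorrelation_nonneg hφ hφs hC _) (Ne.symm hσ)
        have h2 : 0 ≤ G (σ • p) * fourierPlane w (σ • p) := by
          rw [hGw]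
          exact mul_nonneg (by exact_mod_cast sq_nonneg ‖D (σ • p)‖) (hpos _)
        have h3 := mul_nonneg (RCLike.inv_pos_of_pos h1).le h2
        rwa [inv_mul_cancel_left₀ hσ] at h3
    · rw [radon_sum_translate_zero E _ latticePoint hp hh hhs]
      exact Finset.sum_eq_zero fun k hk => by rw [hrad k hk, mul_zero]
  have hD : ∀ᶠ τ in 𝓝 (0 : ℝ), D (τ • p) = 0 := by
    have hne : ∀ᶠ τ in 𝓝 (0 : ℝ), fourierPlane φ (τ • p) ≠ 0 :=
      (continuous_fourierPlane_smul hp hφ hφs).continuousAt.eventually_ne (by simpa using hφ0)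
    filter_upwards [hne] with τ hτ
    have h1 := hprod τ
    rw [hGw] at h1
    simpa using (mul_eq_zero.1 h1).resolve_right hτ
  by_cases hk : k ∈ E
  · exact coeff_eq_zero_of_sum_planeChar_eventually_eq_zero E _ latticePoint p hinj hD k hk
  · exact hE k hk

/-- On the support of `h` a fixed finite part of the lattice sum represents `h`, so `∫ |h|²` is a
finite combination of correlations. -/
lemma eq_zero_of_latticeCorrelation_eq_zero {φ h : Plane → ℂ} {c : ℤ × ℤ → ℂ}
    (hφ : Continuous φ) (hφs : HasCompactSupport φ) (hhs : HasCompactSupport h)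
    (hsum : ∀ x, HasSum (fun k => c k * φ (x - latticePoint k)) (h x))
    (hcor : ∀ k, latticeCorrelation h φ k = 0) : h = 0 := by
  obtain ⟨C, hC⟩ := exists_norm_bound_of_hasCompactSupport hφs
  obtain ⟨r, hr⟩ := exists_norm_bound_of_hasCompactSupport hhs
  have hh : Continuous h := continuous_of_hasSum_lattice hφ hC hsum
  have hpt : ∀ x, ((‖h x‖ ^ 2 : ℝ) : ℂ) = ∑ k ∈ latticeBox (r + C),
      starRingEnd ℂ (c k) * (h x * starRingEnd ℂ (φ (x - latticePoint k))) := by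
    intro x
    by_cases h0 : h x = 0
    · simp [h0]
    rw [Complex.ofReal_pow, ← Complex.mul_conj']
    -- Only the conjugated factor is to be expanded: `map_sum` alters that copy, and the reverse
    -- rewrite then restores the other.
    conv_lhs => rw [apply_eq_sum_latticeBox hC hsum (hr x h0), map_sum,
      ← apply_eq_sum_latticeBox hC hsum (hr x h0), Finset.mul_sum]
    refine Finset.sum_congr rfl fun k _ => ?_
    rw [map_mul]; ring
  have hint : ∫ x, ‖h x‖ ^ 2 = 0 := by
    have h1 : ((∫ x, ‖h x‖ ^ 2 : ℝ) : ℂ) = 0 := by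
      rw [← integral_complex_ofReal]
      simp_rw [hpt]
      rw [integral_finsetSum]
      · refine Finset.sum_eq_zero fun k _ => ?_
        rw [integral_const_mul]
        exact mul_eq_zero_of_right _ (hcor k)
      · intro k _
        have := integrable_mul_conj_translate hh hhs hφ 0 (latticePoint k)
        simp only [sub_zero] at this
        exact this.const_mul _
    exact_mod_cast h1
  have hcont : Continuous fun x => ‖h x‖ ^ 2 := by fun_prop
  have hint2 : Integrable fun x => ‖h x‖ ^ 2 :=
    hcont.integrable_of_hasCompactSupport (hhs.comp_left (g := fun z => ‖z‖ ^ 2) (by simp))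
  have hz := (integral_eq_zero_iff_of_nonneg (fun x => by positivity) hint2).1 hint
  have hz' := (hcont.ae_eq_iff_eq volume continuous_const).1 hz
  funext x
  exact norm_eq_zero.1 ((pow_eq_zero_iff two_ne_zero).1 (congrFun hz' x))

/-! ### Rectangles, index set and admissible directions -/

lemma isCompact_rectangle (l₁ u₁ l₂ u₂ : ℝ) : IsCompact (rectangle l₁ u₁ l₂ u₂) := by
  refine Metric.isCompact_of_isClosed_isBounded ?_ ?_
  · have h0 : Continuous fun x : Plane => x 0 := by fun_prop
    have h1 : Continuous fun x : Plane => x 1 := by fun_prop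
    exact (isClosed_Icc.preimage h0).inter (isClosed_Icc.preimage h1)
  · refine (Metric.isBounded_iff_subset_closedBall 0).2
      ⟨|l₁| + |u₁| + (|l₂| + |u₂|), fun x hx => ?_⟩
    rw [mem_closedBall_zero_iff]
    have h0 : |x 0| ≤ |l₁| + |u₁| := abs_le.2
      ⟨by linarith [hx.1.1, neg_abs_le l₁, abs_nonneg u₁],
        by linarith [hx.1.2, le_abs_self u₁, abs_nonneg l₁]⟩
    have h1 : |x 1| ≤ |l₂| + |u₂| := abs_le.2
      ⟨by linarith [hx.2.1, neg_abs_le l₂, abs_nonneg u₂],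
        by linarith [hx.2.2, le_abs_self u₂, abs_nonneg l₂]⟩
    refine abs_le_of_sq_le_sq' ?_ (by positivity) |>.2
    rw [EuclideanSpace.real_norm_sq_eq, Fin.sum_univ_two]
    have := abs_nonneg (x 0)
    have := abs_nonneg (x 1)
    nlinarith [sq_abs (x 0), sq_abs (x 1)]

lemma mem_shiftIndexSet {N₁ M₁ N₂ M₂ a₁ b₁ a₂ b₂ : ℝ} {x : Plane} {k : ℤ × ℤ}
    (hx : x ∈ rectangle a₁ b₁ a₂ b₂) (hk : x - latticePoint k ∈ rectangle N₁ M₁ N₂ M₂) :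
    k ∈ shiftIndexSet N₁ M₁ N₂ M₂ a₁ b₁ a₂ b₂ := by
  obtain ⟨⟨h1, h2⟩, h3, h4⟩ := hx
  obtain ⟨⟨h5, h6⟩, h7, h8⟩ := hk
  simp only [latticePoint, PiLp.sub_apply, Matrix.cons_val_zero, Matrix.cons_val_one] at h5 h6 h7 h8
  simp only [shiftIndexSet, Finset.mem_product, Finset.mem_Icc, Int.ceil_le, Int.le_floor]
  refine ⟨⟨?_, ?_⟩, ?_, ?_⟩ <;> linarith

lemma norm_direction (θ : ℝ) : ‖direction θ‖ = 1 := by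
  have : ‖direction θ‖ ^ 2 = 1 := by
    rw [EuclideanSpace.real_norm_sq_eq, Fin.sum_univ_two]
    simp [direction]
  exact (pow_eq_one_iff_of_nonneg (norm_nonneg _) two_ne_zero).1 this

lemma injOn_inner_of_notMem_directionSet {E : Finset (ℤ × ℤ)} {θ : ℝ}
    (hθ : direction θ ∉ directionSet (nullSet (differenceSet E))) :
    Set.InjOn (fun k => inner ℝ (latticePoint k) (direction θ)) (E : Set (ℤ × ℤ)) := by
  intro k hk l hl hkl
  by_contra hne
  have h0 : direction θ ≠ 0 := by
    rw [← norm_ne_zero_iff, norm_direction]; exact one_ne_zero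
  -- The direction itself is the null vector: it is orthogonal to the difference of the two lattice
  -- points.
  refine hθ ⟨θ, rfl, direction θ, ⟨h0, latticePoint k - latticePoint l,
    ⟨k, hk, l, hl, hne, rfl⟩, ?_, ?_⟩, h0, by rw [norm_direction, one_smul]⟩
  · exact sub_ne_zero.2 fun h => hne (latticePoint_injective h)
  · rw [inner_sub_left]; exact sub_eq_zero.2 hkl

lemma radon_sub {p : Plane} (hp : ‖p‖ = 1) {f g : Plane → ℂ} (hf : Continuous f)
    (hfs : HasCompactSupport f) (hg : Continuous g) (hgs : HasCompactSupport g) (t : ℝ) :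
    radon p (f - g) t = radon p f t - radon p g t :=
  integral_sub (integrable_line hp hf hfs t) (integrable_line hp hg hgs t)

end

end SingleAngleCT

open SingleAngleCT
theorem theorem5p5 (φ : Plane → ℂ) (N₁ M₁ N₂ M₂ a₁ b₁ a₂ b₂ : ℝ)
    (hφ_cont : Continuous φ)
    (hφ_compact : HasCompactSupport φ)
    (hφ_posDef : IsPositiveDefinite φ)
    (hφ_smooth : ((1 / 2 : ℝ) : EReal) < sobolevSmoothness φ)
    (hφ_nonvanishing : 0 < fourierPlane φ 0)
    (hφ_supp : tsupport φ ⊆ rectangle N₁ M₁ N₂ M₂)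
    (p : Plane)
    (hp : p ∈ directions \
      directionSet (nullSet (differenceSet (shiftIndexSet N₁ M₁ N₂ M₂ a₁ b₁ a₂ b₂))))
    (f g : Plane → ℂ)
    (hf : f ∈ shiftInvariantSpace φ) (hf_supp : tsupport f ⊆ rectangle a₁ b₁ a₂ b₂)
    (hg : g ∈ shiftInvariantSpace φ) (hg_supp : tsupport g ⊆ rectangle a₁ b₁ a₂ b₂)
    (hsamples : ∀ k ∈ shiftIndexSet N₁ M₁ N₂ M₂ a₁ b₁ a₂ b₂,
      radon p f (inner ℝ p (latticePoint k)) = radon p g (inner ℝ p (latticePoint k))) :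
    f = g := by

  obtain ⟨⟨θ, -, rfl⟩, hθ⟩ := hp
  have hpn := norm_direction θ
  obtain ⟨cf, -, hcf⟩ := hf
  obtain ⟨cg, -, hcg⟩ := hg
  obtain ⟨C, hC⟩ := exists_norm_bound_of_hasCompactSupport hφ_compact
  have hf_compact : HasCompactSupport f :=
    (isCompact_rectangle _ _ _ _).of_isClosed_subset (isClosed_tsupport f) hf_supp
  have hg_compact : HasCompactSupport g :=
    (isCompact_rectangle _ _ _ _).of_isClosed_subset (isClosed_tsupport g) hg_supp
  have hfc : Continuous f := continuous_of_hasSum_lattice hφ_cont hC hcf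
  have hgc : Continuous g := continuous_of_hasSum_lattice hφ_cont hC hcg
  have hsum : ∀ x, HasSum (fun k => (cf - cg) k * φ (x - latticePoint k)) ((f - g) x) := fun x => by
    simpa only [Pi.sub_apply, sub_mul] using (hcf x).sub (hcg x)
  have hsupp : ∀ x, (f - g) x ≠ 0 → x ∈ rectangle a₁ b₁ a₂ b₂ := by
    intro x hx
    by_contra hh
    have h1 : f x = 0 := image_eq_zero_of_notMem_tsupport fun h => hh (hf_supp h)
    have h2 : g x = 0 := image_eq_zero_of_notMem_tsupport fun h => hh (hg_supp h)
    exact hx (by simp [h1, h2])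
  have hcomp : HasCompactSupport (f - g) :=
    HasCompactSupport.intro (isCompact_rectangle a₁ b₁ a₂ b₂) fun x hx =>
      by_contra fun h => hx (hsupp x h)
  -- Off the index set the translate `φ(· - k)` and `f - g` are never nonzero at the same point.
  have hE : ∀ k ∉ shiftIndexSet N₁ M₁ N₂ M₂ a₁ b₁ a₂ b₂, latticeCorrelation (f - g) φ k = 0 := by
    intro k hk
    have : ∀ x, (f - g) x * starRingEnd ℂ (φ (x - latticePoint k)) = 0 := by
      intro x
      by_contra hne
      refine hk (mem_shiftIndexSet (hsupp x (left_ne_zero_of_mul hne))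
        (hφ_supp (subset_tsupport _ ?_)))
      exact fun h0 => hne (by simp [h0])
    simp only [latticeCorrelation, this, MeasureTheory.integral_zero]
  rw [← sub_eq_zero]
  refine eq_zero_of_latticeCorrelation_eq_zero hφ_cont hφ_compact hcomp hsum ?_
  refine latticeCorrelation_eq_zero_of_radon_eq_zero hφ_cont hφ_compact
    (fourierPlane_nonneg_of_isPositiveDefinite hφ_posDef hφ_cont hφ_compact) hφ_nonvanishing.ne'
    hcomp hsum _ hE hpn (injOn_inner_of_notMem_directionSet hθ) fun k hk => ?_
  rw [radon_sub hpn hfc hf_compact hgc hg_compact, hsamples k hk, sub_self]
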